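/- Let $n\ge 0$ be an integer and let $E,J,R\in\mathbb R^{n\times n}$ with $E$ and $R$ symmetric positive semidefinite and $J=-J^\top$. Consider the pencil $L(\lambda)=\lambda E-(J-R)$. Recall that a square pencil $\lambda E-A$ is called regular if $\det(\lambda_0E-A)\ne 0$ for some $\lambda_0\in\mathbb C$, and that its index is the size $\sigma$ of the largest block of the form $\lambda\mathcal J_\sigma(0)-I_\sigma$ in its Kronecker canonical form, where $\mathcal J_\sigma(0)$ is the $\sigma\times\sigma$ nilpotent Jordan block (the index is $0$ if there is no such block, in particular if $E$ is invertible). Then $L(\lambda)$ is regular and of index two if and only if there exist an orthogonal matrix $U\in\mathbb R^{n\times n}$ and integers $p,r>0$, $q\ge 0$ with $n=p+q+r$ such that $$U^\top EU=\begin{bmatrix}E_{11}&0&0\\0&0&0\\0&0&0\end{bmatrix},\qquad U^\top JU=\begin{bmatrix}J_{11}&J_{12}&J_{13}\\-J_{12}^\top&J_{22}&0\\-J_{13}^\top&0&0\end{bmatrix},\qquad U^\top RU=\begin{bmatrix}R_{11}&R_{12}&0\\R_{12}^\top&R_{22}&0\\0&0&0\end{bmatrix}$$ with diagonal blocks of sizes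 $p$, $q$, $r$, where $E_{11}\in\mathbb R^{p\times p}$ is invertible, $J_{22}-R_{22}\in\mathbb R^{q\times q}$ is invertible, and $J_{13}\in\mathbb R^{p\times r}$ has full column rank. -/

import Mathlib

open scoped Matrix

namespace DHPencil

/-- The `k × k` upper triangular Jordan block with eigenvalue `μ`. -/
def jordanBlock (k : ℕ) (μ : ℂ) : Matrix (Fin k) (Fin k) ℂ :=
  Matrix.of fun i j => if i = j then μ else if (j : ℕ) = (i : ℕ) + 1 then 1 else 0

/-- The types of diagonal blocks of the Kronecker canonical form of a pencil `z E - A`.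
Rectangular blocks may have size parameter `0`; the square blocks have positive size. -/
inductive KroneckerBlock : Type
  /-- The right Kronecker block of size `ε × (ε + 1)`. -/
  | right (ε : ℕ)
  /-- The transpose of a right Kronecker block, of size `(η + 1) × η`. -/
  | left (η : ℕ)
  /-- The block `z I - 𝒥_ρ(μ)` of a finite eigenvalue `μ`. -/
  | finite (ρ : ℕ) (hρ : 0 < ρ) (μ : ℂ)
  /-- The block `z 𝒥_σ(0) - I` of the eigenvalue infinity. -/
  | infinite (σ : ℕ) (hσ : 0 < σ)

namespace KroneckerBlock

/-- Number of rows of a block. -/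
def rows : KroneckerBlock → ℕ
  | right ε => ε
  | left η => η + 1
  | finite ρ _ _ => ρ
  | infinite σ _ => σ

/-- Number of columns of a block. -/
def cols : KroneckerBlock → ℕ
  | right ε => ε + 1
  | left η => η
  | finite ρ _ _ => ρ
  | infinite σ _ => σ

/-- The matrix `E` of the block `z E - A`. -/
def leadMatrix : (b : KroneckerBlock) → Matrix (Fin b.rows) (Fin b.cols) ℂ
  | right ε => (Matrix.of fun i j => if (j : ℕ) = (i : ℕ) then 1 else 0 :
      Matrix (Fin ε) (Fin (ε + 1)) ℂ)
  | left η => (Matrix.of fun i j => if (i : ℕ) = (j : ℕ) then 1 else 0 :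
      Matrix (Fin (η + 1)) (Fin η) ℂ)
  | finite ρ _ _ => (1 : Matrix (Fin ρ) (Fin ρ) ℂ)
  | infinite σ _ => jordanBlock σ 0

/-- The matrix `A` of the block `z E - A`. -/
def constMatrix : (b : KroneckerBlock) → Matrix (Fin b.rows) (Fin b.cols) ℂ
  | right ε => (Matrix.of fun i j => if (j : ℕ) = (i : ℕ) + 1 then 1 else 0 :
      Matrix (Fin ε) (Fin (ε + 1)) ℂ)
  | left η => (Matrix.of fun i j => if (i : ℕ) = (j : ℕ) + 1 then 1 else 0 :
      Matrix (Fin (η + 1)) (Fin η) ℂ)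
  | finite ρ _ μ => jordanBlock ρ μ
  | infinite σ _ => (1 : Matrix (Fin σ) (Fin σ) ℂ)

/-- The size of a block if it belongs to the eigenvalue infinity, and `0` for all other blocks. -/
def sizeAtInfinity : KroneckerBlock → ℕ
  | infinite σ _ => σ
  | _ => 0

end KroneckerBlock

/-- The finite family `b` of blocks is a Kronecker canonical form of the pencil `z E - A`:
there are nonsingular `S`, `T` such that `S (z E - A) T` is block diagonal with diagonal
blocks `b 0, …, b (k - 1)`. The bijections `e`, `f` only number the rows and columns of the block
diagonal matrix, and are in particular responsible for its having the size of `E` and `A`. -/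
def IsKroneckerForm {m n : ℕ} (E A : Matrix (Fin m) (Fin n) ℂ)
    {k : ℕ} (b : Fin k → KroneckerBlock) : Prop :=
  ∃ (S : Matrix (Fin m) (Fin m) ℂ) (T : Matrix (Fin n) (Fin n) ℂ)
    (e : Fin m ≃ (Σ i, Fin (b i).rows)) (f : Fin n ≃ (Σ i, Fin (b i).cols)),
    IsUnit S ∧ IsUnit T ∧
    S * E * T = (Matrix.blockDiagonal' fun i => (b i).leadMatrix).submatrix e f ∧
    S * A * T = (Matrix.blockDiagonal' fun i => (b i).constMatrix).submatrix e f

/-- The pencil `z E - A` has index `ν`: this is the size of the largest block of the eigenvalue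
infinity in its Kronecker canonical form (which is unique up to permutation of the blocks),
and `0` if there is no such block. -/
def HasIndex {m n : ℕ} (E A : Matrix (Fin m) (Fin n) ℂ) (ν : ℕ) : Prop :=
  ∃ (k : ℕ) (b : Fin k → KroneckerBlock), IsKroneckerForm E A b ∧
    (Finset.univ.sup fun i => (b i).sizeAtInfinity) = ν

/-- The square pencil `z E - A` is regular. -/
def IsRegular {n : ℕ} (E A : Matrix (Fin n) (Fin n) ℂ) : Prop :=
  ∃ z : ℂ, (z • E - A).det ≠ 0

/-- A real matrix, regarded as a complex one. -/
noncomputable def toComplex {m n : ℕ} (M : Matrix (Fin m) (Fin n) ℝ) :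
    Matrix (Fin m) (Fin n) ℂ :=
  M.map Complex.ofReal

/-- The `n × n` matrix with the given `3 × 3` block structure, where `n = p + q + r`. -/
def block3 {n p q r : ℕ} (h : p + q + r = n)
    (M₁₁ : Matrix (Fin p) (Fin p) ℝ) (M₁₂ : Matrix (Fin p) (Fin q) ℝ)
    (M₁₃ : Matrix (Fin p) (Fin r) ℝ)
    (M₂₁ : Matrix (Fin q) (Fin p) ℝ) (M₂₂ : Matrix (Fin q) (Fin q) ℝ)
    (M₂₃ : Matrix (Fin q) (Fin r) ℝ)
    (M₃₁ : Matrix (Fin r) (Fin p) ℝ) (M₃₂ : Matrix (Fin r) (Fin q) ℝ)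
    (M₃₃ : Matrix (Fin r) (Fin r) ℝ) : Matrix (Fin n) (Fin n) ℝ :=
  let e : (Fin p ⊕ Fin q) ⊕ Fin r ≃ Fin n :=
    ((finSumFinEquiv.sumCongr (Equiv.refl (Fin r))).trans finSumFinEquiv).trans (finCongr h)
  Matrix.reindex e e
    (Matrix.fromBlocks
      (Matrix.fromBlocks M₁₁ M₁₂ M₂₁ M₂₂) (Matrix.fromRows M₁₃ M₂₃)
      (Matrix.fromCols M₃₁ M₃₂) M₃₃)

end DHPencil

/-! Both sides reduce to two statements about kernels. Since `J` is skew, its quadratic form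
vanishes, so pairing an equation with a vector isolates the semidefinite forms of `E` and `R`. In
this way regularity becomes triviality of `ker E ∩ ker R ∩ ker J` (`isRegular_iff`), and a regular
pencil has no Jordan chain of length three at infinity (`eq_zero_of_chain`). Index two then means
that some `x ≠ 0` satisfies `E x = 0` and `(J - R) x = E y` (`hasIndex_two_iff`); this uses the
existence of a Weierstrass form, but not uniqueness of Kronecker forms.

Given the block form, both kernel conditions are read off (`exists_chain_of_block3`). Conversely,
let `K₀ = ker E` and let `K₁` be the kernel of the compression of `J - R` to `K₀`. An orthonormal
basis adapted to `K₀ᗮ`, `K₁ᗮ ⊓ K₀`, `K₁` gives the three blocks (`exists_block3_of_chain`). -/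

namespace DHPencil

/-! ### Weierstrass form of a regular pencil and Jordan chains at infinity. -/

section Kronecker

open Polynomial

/-- Regrouping of a vector along a numbering of the entries of a family of vectors. -/
noncomputable def regroup {m k : ℕ} {d : Fin k → ℕ} (e : Fin m ≃ (Σ i, Fin (d i))) :
    (∀ i, Fin (d i) → ℂ) ≃ₗ[ℂ] (Fin m → ℂ) :=
  (LinearEquiv.piCurry ℂ fun (i : Fin k) (_ : Fin (d i)) => ℂ).symm.trans
    (LinearEquiv.funCongrLeft ℂ ℂ e)

theorem regroup_apply {m k : ℕ} {d : Fin k → ℕ} (e : Fin m ≃ (Σ i, Fin (d i)))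
    (v : ∀ i, Fin (d i) → ℂ) (a : Fin m) : regroup e v a = v (e a).1 (e a).2 := rfl

theorem blockDiagonal'_submatrix_mulVec {m n k : ℕ} {c d : Fin k → ℕ}
    (D : ∀ i, Matrix (Fin (c i)) (Fin (d i)) ℂ)
    (e : Fin m ≃ (Σ i, Fin (c i))) (f : Fin n ≃ (Σ i, Fin (d i))) (v : ∀ i, Fin (d i) → ℂ) :
    (Matrix.blockDiagonal' D).submatrix e f *ᵥ regroup f v = regroup e fun i => D i *ᵥ v i := by
  ext a
  rw [regroup_apply]
  simp only [Matrix.mulVec, dotProduct, Matrix.submatrix_apply, regroup_apply]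
  rw [f.sum_comp (fun s => Matrix.blockDiagonal' D (e a) s * v s.1 s.2), Fintype.sum_sigma,
    Finset.sum_eq_single (e a).1]
  · exact Finset.sum_congr rfl fun j _ => by rw [← Matrix.blockDiagonal'_apply_eq D]
  · intro i _ hi
    refine Finset.sum_eq_zero fun j _ => ?_
    rw [Matrix.blockDiagonal'_apply_ne D _ _ hi.symm, zero_mul]
  · simp

/-- Coordinate-free version, with `φ` and `ψ` in the roles of `T⁻¹` and `S`. In the converse the
numberings `e` and `f` come from a dimension count alone; `S` and `T` absorb the choice. -/
theorem isKroneckerForm_iff {m n : ℕ} (E A : Matrix (Fin m) (Fin n) ℂ)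
    {k : ℕ} (b : Fin k → KroneckerBlock) :
    IsKroneckerForm E A b ↔
      ∃ (φ : (Fin n → ℂ) ≃ₗ[ℂ] (∀ i, Fin (b i).cols → ℂ))
        (ψ : (Fin m → ℂ) ≃ₗ[ℂ] (∀ i, Fin (b i).rows → ℂ)),
        ∀ x, (ψ (E *ᵥ x) = fun i => (b i).leadMatrix *ᵥ φ x i) ∧
          ψ (A *ᵥ x) = fun i => (b i).constMatrix *ᵥ φ x i := by
  constructor
  · rintro ⟨S, T, e, f, hS, hT, h1, h2⟩
    have hdS := (Matrix.isUnit_iff_isUnit_det S).mp hS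
    have hdT := (Matrix.isUnit_iff_isUnit_det T).mp hT
    let σ : (Fin m → ℂ) ≃ₗ[ℂ] (Fin m → ℂ) :=
      LinearEquiv.ofLinearMap (Matrix.mulVecLin S) (Matrix.mulVecLin S⁻¹)
        (by rw [← Matrix.mulVecLin_mul, Matrix.mul_nonsing_inv _ hdS, Matrix.mulVecLin_one])
        (by rw [← Matrix.mulVecLin_mul, Matrix.nonsing_inv_mul _ hdS, Matrix.mulVecLin_one])
    let τ : (Fin n → ℂ) ≃ₗ[ℂ] (Fin n → ℂ) :=
      LinearEquiv.ofLinearMap (Matrix.mulVecLin T⁻¹) (Matrix.mulVecLin T)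
        (by rw [← Matrix.mulVecLin_mul, Matrix.nonsing_inv_mul _ hdT, Matrix.mulVecLin_one])
        (by rw [← Matrix.mulVecLin_mul, Matrix.mul_nonsing_inv _ hdT, Matrix.mulVecLin_one])
    have key : ∀ (M : Matrix (Fin m) (Fin n) ℂ)
        (D : ∀ i, Matrix (Fin (b i).rows) (Fin (b i).cols) ℂ),
        S * M * T = (Matrix.blockDiagonal' D).submatrix e f → ∀ x,
        σ.trans (regroup e).symm (M *ᵥ x) =
          fun i => D i *ᵥ (τ.trans (regroup f).symm) x i := by
      intro M D h x
      rw [LinearEquiv.trans_apply, LinearEquiv.symm_apply_eq,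
        ← blockDiagonal'_submatrix_mulVec D e f, ← h]
      simp only [LinearEquiv.trans_apply, LinearEquiv.apply_symm_apply]
      change S *ᵥ (M *ᵥ x) = (S * M * T) *ᵥ (T⁻¹ *ᵥ x)
      rw [Matrix.mulVec_mulVec, Matrix.mulVec_mulVec, Matrix.mul_assoc (S * M),
        Matrix.mul_nonsing_inv _ hdT, Matrix.mul_one]
    exact ⟨τ.trans (regroup f).symm, σ.trans (regroup e).symm,
      fun x => ⟨key E _ h1 x, key A _ h2 x⟩⟩
  · rintro ⟨φ, ψ, h⟩
    have hcard : ∀ {m : ℕ} {d : Fin k → ℕ}, ((Fin m → ℂ) ≃ₗ[ℂ] (∀ i, Fin (d i) → ℂ)) →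
        Nonempty (Fin m ≃ (Σ i, Fin (d i))) := by
      intro m d θ
      refine ⟨Fintype.equivOfCardEq ?_⟩
      have := θ.finrank_eq
      rw [Module.finrank_fin_fun, Module.finrank_pi_fintype] at this
      simpa using this
    obtain ⟨e⟩ := hcard ψ
    obtain ⟨f⟩ := hcard φ
    have key : ∀ (M : Matrix (Fin m) (Fin n) ℂ)
        (D : ∀ i, Matrix (Fin (b i).rows) (Fin (b i).cols) ℂ),
        (∀ x, ψ (M *ᵥ x) = fun i => D i *ᵥ φ x i) →
        LinearMap.toMatrix' (ψ.trans (regroup e)).toLinearMap * M *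
          LinearMap.toMatrix' (φ.trans (regroup f)).symm.toLinearMap =
            (Matrix.blockDiagonal' D).submatrix e f := by
      intro M D hM
      refine Matrix.mulVec_injective (funext fun v => ?_)
      obtain ⟨w, rfl⟩ := (φ.trans (regroup f)).surjective v
      rw [← Matrix.mulVec_mulVec, ← Matrix.mulVec_mulVec, LinearMap.toMatrix'_mulVec,
        LinearMap.toMatrix'_mulVec, LinearEquiv.coe_coe, LinearEquiv.coe_coe,
        LinearEquiv.symm_apply_apply, LinearEquiv.trans_apply, LinearEquiv.trans_apply,
        hM, blockDiagonal'_submatrix_mulVec]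
    have unit : ∀ {m : ℕ} (θ : (Fin m → ℂ) ≃ₗ[ℂ] (Fin m → ℂ)),
        IsUnit (LinearMap.toMatrix' θ.toLinearMap) := by
      intro m θ
      refine IsUnit.of_mul_eq_one (LinearMap.toMatrix' θ.symm.toLinearMap) ?_
      rw [← LinearMap.toMatrix'_comp]
      simp
    exact ⟨_, _, e, f, unit _, unit _, key E _ fun x => (h x).1, key A _ fun x => (h x).2⟩

/-- A nilpotent endomorphism of maximal nilpotency degree is a single Jordan block. -/
theorem exists_equiv_jordanBlock_zero {V : Type*} [AddCommGroup V] [Module ℂ V]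
    {k : ℕ} (hk : 0 < k) (hV : Module.finrank ℂ V = k) (D : Module.End ℂ V)
    (h0 : D ^ k = 0) (h1 : D ^ (k - 1) ≠ 0) :
    ∃ φ : V ≃ₗ[ℂ] (Fin k → ℂ), ∀ x, φ (D x) = jordanBlock k 0 *ᵥ φ x := by
  obtain ⟨v, hv⟩ : ∃ v, (D ^ (k - 1)) v ≠ 0 := by
    by_contra! h
    exact h1 (LinearMap.ext h)
  have hli : LinearIndependent ℂ fun j : Fin k => (D ^ (j : ℕ)) v := by
    rw [Fintype.linearIndependent_iff]
    intro c hc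
    suffices ∀ m (hm : m < k), c ⟨m, hm⟩ = 0 from fun i => this i i.2
    intro m
    induction m using Nat.strong_induction_on with
    | _ m ih =>
      intro hm
      -- This power of `D` kills every term of index above `m`; those below vanish by induction.
      -- Only `c m • D ^ (k - 1) v` survives.
      have := congrArg (D ^ (k - 1 - m)) hc
      rw [map_sum, Finset.sum_eq_single ⟨m, hm⟩] at this
      · simp only [map_smul, map_zero, ← Module.End.mul_apply, ← pow_add,
          show k - 1 - m + m = k - 1 by omega] at this
        exact (smul_eq_zero.mp this).resolve_right hv
      · intro i _ hi
        rcases lt_or_gt_of_ne (fun h => hi (Fin.ext h) : (i : ℕ) ≠ m) with h | h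
        · simp [ih i h i.2]
        · rw [map_smul, ← Module.End.mul_apply, ← pow_add,
            show k - 1 - m + (i : ℕ) = k + (i - 1 - m) by omega, pow_add, h0]
          simp
      · simp
  have : Nonempty (Fin k) := ⟨⟨0, hk⟩⟩
  -- The order is reversed because the upper triangular block sends the `j`-th basis vector to the
  -- one before it.
  let B := (basisOfLinearIndependentOfCardEqFinrank hli (by simp [hV])).reindex Fin.revPerm
  have hB : ∀ j : Fin k, B j = (D ^ (k - 1 - j : ℕ)) v := by
    intro j
    simp [B, Fin.val_rev, Nat.sub_sub, add_comm]
  refine ⟨B.equivFun, fun x => ?_⟩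
  have key : B.equivFun.toLinearMap ∘ₗ D =
      (Matrix.mulVecLin (jordanBlock k 0)) ∘ₗ B.equivFun.toLinearMap := by
    refine B.ext fun j => ?_
    simp only [LinearMap.comp_apply, LinearEquiv.coe_coe, Matrix.mulVecLin_apply]
    have hB1 : ∀ j, B.equivFun (B j) = Pi.single j 1 := by
      intro j
      simp [Finsupp.single_eq_pi_single]
    have hcol : jordanBlock k 0 *ᵥ Pi.single j 1 = fun i => jordanBlock k 0 i j := by
      ext i; simp
    have hD : D (B j) = if h : 0 < (j : ℕ) then B ⟨j - 1, by omega⟩ else 0 := by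
      rw [hB, ← Module.End.mul_apply, ← pow_succ']
      split_ifs with h
      · rw [hB]
        congr 2
        simp only
        omega
      · rw [show k - 1 - (j : ℕ) + 1 = k by omega, h0]
        rfl
    rw [hB1, hcol, hD]
    split_ifs with h
    · rw [hB1]
      ext i
      simp only [jordanBlock, Matrix.of_apply, Pi.single_apply, Fin.ext_iff]
      split_ifs <;> first | rfl | omega
    · rw [map_zero]
      ext i
      simp only [jordanBlock, Matrix.of_apply, Pi.zero_apply]
      split_ifs <;> first | rfl | omega
  exact LinearMap.congr_fun key x

theorem jordanBlock_mulVec (k : ℕ) (μ : ℂ) (v : Fin k → ℂ) :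
    jordanBlock k μ *ᵥ v = jordanBlock k 0 *ᵥ v + μ • v := by
  have : jordanBlock k μ = jordanBlock k 0 + μ • 1 := by
    ext i j
    by_cases h : i = j <;> simp [jordanBlock, h]
  rw [this, Matrix.add_mulVec, Matrix.smul_mulVec, Matrix.one_mulVec]

/-- The block belongs to a finite or an infinite eigenvalue. -/
def KroneckerBlock.IsSquare : KroneckerBlock → Prop
  | .finite _ _ _ => True
  | .infinite _ _ => True
  | _ => False

/-- A local algebra generated by `x` carries a single block of the pencil `(z - z₀) x + 1`. -/
theorem exists_block_of_nilpotent {Q : Type*} [CommRing Q] [Algebra ℂ Q] {k : ℕ} (hk : 0 < k)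
    (hQ : Module.finrank ℂ Q = k) (x : Q) (μ z₀ : ℂ)
    (h0 : (x - algebraMap ℂ Q μ) ^ k = 0) (h1 : (x - algebraMap ℂ Q μ) ^ (k - 1) ≠ 0) :
    ∃ (b : KroneckerBlock) (φ : Q ≃ₗ[ℂ] (Fin b.cols → ℂ)) (ψ : Q ≃ₗ[ℂ] (Fin b.rows → ℂ)),
      b.IsSquare ∧ ∀ q, ψ (x * q) = b.leadMatrix *ᵥ φ q ∧
        ψ ((algebraMap ℂ Q z₀ * x - 1) * q) = b.constMatrix *ᵥ φ q := by
  -- A unit factor does not change the degree of nilpotency, so each such multiplication is again a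
  -- single Jordan block.
  have chain : ∀ u : Qˣ, ∃ φ : Q ≃ₗ[ℂ] (Fin k → ℂ), ∀ q,
      φ ((u * (x - algebraMap ℂ Q μ)) * q) = jordanBlock k 0 *ᵥ φ q := by
    intro u
    refine exists_equiv_jordanBlock_zero hk hQ
      (Algebra.lmul ℂ Q (u * (x - algebraMap ℂ Q μ))) ?_ ?_
    · rw [← map_pow, mul_pow, h0, mul_zero, map_zero]
    · rw [← map_pow, mul_pow]
      intro h
      have := LinearMap.congr_fun h 1
      simp only [Algebra.coe_lmul_eq_mul, LinearMap.mul_apply', mul_one,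
        LinearMap.zero_apply] at this
      rw [← Units.val_pow_eq_pow_val, Units.mul_right_eq_zero] at this
      exact h1 this
  have unitEquiv : ∀ u : Qˣ, ∃ θ : Q ≃ₗ[ℂ] Q, ∀ q, θ q = u * q := fun u =>
    ⟨LinearEquiv.ofLinearMap (Algebra.lmul ℂ Q u) (Algebra.lmul ℂ Q (u⁻¹ : Qˣ))
      (by ext; simp) (by ext; simp), fun q => by simp⟩
  have hnil : IsNilpotent (x - algebraMap ℂ Q μ) := ⟨k, h0⟩
  -- For `μ = 0` the element `z₀ x - 1` is a unit, and dividing by it gives an infinite block.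
  -- Otherwise `x` is a unit, and dividing by `x` gives a finite block.
  by_cases hμ : μ = 0
  · subst hμ
    rw [map_zero, sub_zero] at *
    obtain ⟨w, hw⟩ : IsUnit (algebraMap ℂ Q z₀ * x - 1) := by
      rw [← IsUnit.neg_iff, neg_sub]
      exact ((Commute.all _ _).isNilpotent_mul_left hnil).isUnit_one_sub
    obtain ⟨φ, hφ⟩ := chain w⁻¹
    obtain ⟨θ, hθ⟩ := unitEquiv w⁻¹
    have lead : ∀ q, θ.trans φ (x * q) = jordanBlock k 0 *ᵥ φ q := fun q => by
      rw [LinearEquiv.trans_apply, hθ, ← mul_assoc]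
      exact hφ q
    have const : ∀ q, θ.trans φ ((algebraMap ℂ Q z₀ * x - 1) * q) =
        (1 : Matrix (Fin k) (Fin k) ℂ) *ᵥ φ q := fun q => by
      rw [LinearEquiv.trans_apply, hθ, ← hw, Units.inv_mul_cancel_left, Matrix.one_mulVec]
    exact ⟨.infinite k hk, φ, θ.trans φ, trivial, fun q => ⟨lead q, const q⟩⟩
  · obtain ⟨w, hw⟩ : IsUnit x := by
      have : IsUnit (algebraMap ℂ Q μ) := (isUnit_iff_ne_zero.mpr hμ).map _
      have h := hnil.isUnit_add_left_of_commute this (Commute.all _ _)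
      simpa using h
    obtain ⟨m, hm⟩ : IsUnit (algebraMap ℂ Q μ⁻¹) :=
      (isUnit_iff_ne_zero.mpr (inv_ne_zero hμ)).map _
    -- The factor comes from `z₀ - x⁻¹ = (z₀ - μ⁻¹) + μ⁻¹ x⁻¹ (x - μ)`.
    obtain ⟨φ, hφ⟩ := chain (m * w⁻¹)
    obtain ⟨θ, hθ⟩ := unitEquiv w⁻¹
    have lead : ∀ q, θ.trans φ (x * q) = (1 : Matrix (Fin k) (Fin k) ℂ) *ᵥ φ q := fun q => by
      rw [LinearEquiv.trans_apply, hθ, ← hw, Units.inv_mul_cancel_left, Matrix.one_mulVec]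
    have const : ∀ q, θ.trans φ ((algebraMap ℂ Q z₀ * x - 1) * q) =
        jordanBlock k (z₀ - μ⁻¹) *ᵥ φ q := fun q => by
      rw [jordanBlock_mulVec, LinearEquiv.trans_apply, hθ, ← hφ q, ← map_smul, ← map_add]
      congr 1
      rw [Algebra.smul_def, map_sub, Units.val_mul, hm, ← hw]
      have e1 : (↑w⁻¹ : Q) * w = 1 := w.inv_mul
      have e2 : algebraMap ℂ Q μ⁻¹ * algebraMap ℂ Q μ = 1 := by
        rw [← map_mul, inv_mul_cancel₀ hμ, map_one]
      linear_combination (algebraMap ℂ Q z₀ * q - algebraMap ℂ Q μ⁻¹ * q) * e1 + (↑w⁻¹ * q) * e2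
    exact ⟨.finite k hk (z₀ - μ⁻¹), φ, θ.trans φ, trivial, fun q => ⟨lead q, const q⟩⟩

/-- Over `ℂ` the polynomial `p` is associated to some `X - μ`, so the quotient has dimension `k` and
`(X - μ) ^ j` vanishes in it exactly when `k ≤ j`. -/
theorem exists_block_of_cyclic {p : ℂ[X]} (hp : Irreducible p) {k : ℕ} (hk : 0 < k) (z₀ : ℂ) :
    ∃ (b : KroneckerBlock) (φ : (ℂ[X] ⧸ ℂ[X] ∙ p ^ k) ≃ₗ[ℂ] (Fin b.cols → ℂ))
      (ψ : (ℂ[X] ⧸ ℂ[X] ∙ p ^ k) ≃ₗ[ℂ] (Fin b.rows → ℂ)),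
      b.IsSquare ∧ ∀ q, ψ ((X : ℂ[X]) • q) = b.leadMatrix *ᵥ φ q ∧
        ψ ((C z₀ * X - 1 : ℂ[X]) • q) = b.constMatrix *ᵥ φ q := by
  have hdeg := IsAlgClosed.degree_eq_one_of_irreducible ℂ hp
  obtain ⟨μ, hμ⟩ := exists_root_of_degree_eq_one hdeg
  have hass : Associated p (X - C μ) :=
    ((irreducible_X_sub_C μ).associated_of_dvd hp (dvd_iff_isRoot.mpr hμ)).symm
  have hmem : ∀ j, (p ^ k ∣ (X - C μ) ^ j ↔ k ≤ j) := fun j => by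
    rw [(hass.pow_pow (n := k)).dvd_iff_dvd_left]
    exact pow_dvd_pow_iff (X_sub_C_ne_zero μ) (not_isUnit_X_sub_C μ)
  have hfin : Module.finrank ℂ (ℂ[X] ⧸ (Ideal.span {p ^ k} : Ideal ℂ[X])) = k := by
    rw [finrank_quotient_span_eq_natDegree, natDegree_pow,
      natDegree_eq_of_degree_eq_some (n := 1) hdeg, mul_one]
  have hpow : ∀ j, ((Ideal.Quotient.mk (Ideal.span {p ^ k}) X -
      algebraMap ℂ (ℂ[X] ⧸ (Ideal.span {p ^ k} : Ideal ℂ[X])) μ) ^ j = 0 ↔ k ≤ j) := fun j => by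
    have : algebraMap ℂ (ℂ[X] ⧸ (Ideal.span {p ^ k} : Ideal ℂ[X])) μ =
        Ideal.Quotient.mk _ (C μ) := rfl
    rw [this, ← map_sub, ← map_pow, Ideal.Quotient.eq_zero_iff_mem, Ideal.mem_span_singleton, hmem]
  obtain ⟨b, φ, ψ, hb, h⟩ := exists_block_of_nilpotent hk hfin
    (Ideal.Quotient.mk (Ideal.span {p ^ k}) X) μ z₀ ((hpow k).mpr le_rfl)
    (fun h => by have := (hpow (k - 1)).mp h; omega)
  refine ⟨b, φ, ψ, hb, fun q => ?_⟩
  obtain ⟨q, rfl⟩ := Ideal.Quotient.mk_surjective q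
  exact h (Ideal.Quotient.mk _ q)

/-- Every square matrix `M` is a direct sum of blocks of the pencil `z M - (z₀ M - 1)`. -/
theorem exists_blocks_of_endomorphism {V : Type} [AddCommGroup V] [Module ℂ V]
    [FiniteDimensional ℂ V] (M : Module.End ℂ V) (z₀ : ℂ) :
    ∃ (k : ℕ) (b : Fin k → KroneckerBlock)
      (φ : V ≃ₗ[ℂ] (∀ i, Fin (b i).cols → ℂ)) (ψ : V ≃ₗ[ℂ] (∀ i, Fin (b i).rows → ℂ)),
      (∀ i, (b i).IsSquare) ∧ ∀ x, (ψ (M x) = fun i => (b i).leadMatrix *ᵥ φ x i) ∧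
        ψ (z₀ • M x - x) = fun i => (b i).constMatrix *ᵥ φ x i := by
  classical
  obtain ⟨ι, _, p, hp, e, ⟨θ⟩⟩ := Module.equiv_directSum_of_isTorsion
    (Module.AEval.isTorsion_of_finiteDimensional ℂ V M)
  let Q : ι → Type := fun i => ℂ[X] ⧸ ℂ[X] ∙ p i ^ e i
  let ξ : V ≃ₗ[ℂ] (∀ i, Q i) := (Module.AEval'.of M).trans
    ((θ.trans (DirectSum.linearEquivFunOnFintype ℂ[X] ι Q)).restrictScalars ℂ)
  have hξ : ∀ x i, ξ (M x) i = (X : ℂ[X]) • ξ x i := fun x i => by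
    have : Module.AEval'.of M (M x) = (X : ℂ[X]) • Module.AEval'.of M x :=
      (Module.AEval'.X_smul_of M x).symm
    change (θ.trans (DirectSum.linearEquivFunOnFintype ℂ[X] ι Q)) (Module.AEval'.of M (M x)) i = _
    rw [this, map_smul]
    rfl
  have hξ' : ∀ x i, ξ (z₀ • M x - x) i = (C z₀ * X - 1 : ℂ[X]) • ξ x i := fun x i => by
    rw [map_sub, map_smul, Pi.sub_apply, Pi.smul_apply, hξ, sub_smul, mul_smul, one_smul,
      ← algebraMap_eq, algebraMap_smul]
  -- The structure theorem allows zero exponents. These summands are trivial and are discarded,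
  -- since square blocks have positive size.
  have hsub : ∀ i, e i = 0 → ∀ q : Q i, q = 0 := fun i hi q => by
    obtain ⟨q, rfl⟩ := Submodule.Quotient.mk_surjective _ q
    rw [Submodule.Quotient.mk_eq_zero, hi, pow_zero]
    exact Ideal.mem_span_singleton.mpr (one_dvd q)
  let κ : (∀ i, Q i) ≃ₗ[ℂ] (∀ a : {i // e i ≠ 0}, Q a) :=
    LinearEquiv.ofBijective
      (LinearMap.pi fun a : {i // e i ≠ 0} => LinearMap.proj (R := ℂ) (φ := Q) a.1) <| by
      constructor
      · refine (injective_iff_map_eq_zero _).mpr fun y hy => ?_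
        ext i
        by_cases hi : e i = 0
        · exact hsub i hi _
        · exact congrFun hy ⟨i, hi⟩
      · intro v
        refine ⟨fun i => if hi : e i ≠ 0 then v ⟨i, hi⟩ else 0, funext fun a => ?_⟩
        exact dif_pos a.2
  let g : Fin (Fintype.card {i // e i ≠ 0}) ≃ {i // e i ≠ 0} := (Fintype.equivFin _).symm
  choose b φ ψ hb h using fun a => exists_block_of_cyclic (hp (g a))
    (Nat.pos_of_ne_zero (g a).2) z₀
  let χ := (ξ.trans κ).trans (LinearEquiv.piCongrLeft ℂ (fun a : {i // e i ≠ 0} => Q a) g).symm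
  have hχ : ∀ x a, χ x a = ξ x (g a) := fun x a => rfl
  refine ⟨_, b, χ.trans (LinearEquiv.piCongrRight φ), χ.trans (LinearEquiv.piCongrRight ψ), hb,
    fun x => ⟨funext fun a => ?_, funext fun a => ?_⟩⟩
  · simp only [LinearEquiv.trans_apply, LinearEquiv.piCongrRight_apply, hχ, hξ]
    exact (h a _).1
  · simp only [LinearEquiv.trans_apply, LinearEquiv.piCongrRight_apply, hχ, hξ']
    exact (h a _).2

/-- The Weierstrass canonical form of a regular pencil. -/
theorem IsRegular.exists_isKroneckerForm {n : ℕ} {E A : Matrix (Fin n) (Fin n) ℂ}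
    (h : IsRegular E A) :
    ∃ (k : ℕ) (b : Fin k → KroneckerBlock), IsKroneckerForm E A b ∧ ∀ i, (b i).IsSquare := by
  obtain ⟨z₀, hz⟩ := h
  have hu : IsUnit (z₀ • E - A).det := isUnit_iff_ne_zero.mpr hz
  set P := (z₀ • E - A)⁻¹ with hP
  let π : (Fin n → ℂ) ≃ₗ[ℂ] (Fin n → ℂ) :=
    LinearEquiv.ofLinearMap (Matrix.mulVecLin P) (Matrix.mulVecLin (z₀ • E - A))
      (by rw [← Matrix.mulVecLin_mul, Matrix.nonsing_inv_mul _ hu, Matrix.mulVecLin_one])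
      (by rw [← Matrix.mulVecLin_mul, Matrix.mul_nonsing_inv _ hu, Matrix.mulVecLin_one])
  -- With `M = P E` one has `P A = z₀ M - 1`, so the pencil is equivalent to `z M - (z₀ M - 1)`.
  obtain ⟨k, b, φ, ψ, hb, hφ⟩ := exists_blocks_of_endomorphism (Matrix.mulVecLin (P * E)) z₀
  refine ⟨k, b, (isKroneckerForm_iff E A b).mpr ⟨φ, π.trans ψ, fun x => ⟨?_, ?_⟩⟩, hb⟩
  · rw [← (hφ x).1, LinearEquiv.trans_apply, Matrix.mulVecLin_apply, ← Matrix.mulVec_mulVec]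
    rfl
  · rw [← (hφ x).2, LinearEquiv.trans_apply]
    congr 1
    change P *ᵥ (A *ᵥ x) = _
    have : P * A = z₀ • (P * E) - 1 := by
      rw [← Matrix.nonsing_inv_mul _ hu, ← hP, Matrix.mul_sub, Matrix.mul_smul, sub_sub_cancel]
    rw [Matrix.mulVec_mulVec, this, Matrix.sub_mulVec, Matrix.smul_mulVec, Matrix.one_mulVec,
      Matrix.mulVecLin_apply]

theorem jordanBlock_zero_mulVec_single_zero {σ : ℕ} (h : 0 < σ) :
    jordanBlock σ 0 *ᵥ Pi.single ⟨0, h⟩ 1 = 0 := by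
  ext i
  simp [jordanBlock]

theorem jordanBlock_zero_mulVec_single_succ {σ j : ℕ} (h : j + 1 < σ) :
    jordanBlock σ 0 *ᵥ Pi.single ⟨j + 1, h⟩ 1 = Pi.single ⟨j, by omega⟩ 1 := by
  ext i
  simp only [jordanBlock, Matrix.mulVec_single_one, Matrix.col_apply, Matrix.of_apply,
    Pi.single_apply, Fin.ext_iff]
  split_ifs <;> first | rfl | omega

/-- A block of the eigenvalue infinity gives a Jordan chain of the pencil. -/
theorem IsKroneckerForm.exists_chain {m n : ℕ} {E A : Matrix (Fin m) (Fin n) ℂ} {k : ℕ}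
    {b : Fin k → KroneckerBlock} (h : IsKroneckerForm E A b) {i : Fin k}
    (hi : 0 < (b i).sizeAtInfinity) :
    ∃ x : ℕ → Fin n → ℂ, x 0 ≠ 0 ∧ E *ᵥ x 0 = 0 ∧
      ∀ j, j + 1 < (b i).sizeAtInfinity → A *ᵥ x j = E *ᵥ x (j + 1) := by
  obtain ⟨φ, ψ, h⟩ := (isKroneckerForm_iff E A b).mp h
  obtain ⟨σ, hσ, hbi⟩ : ∃ σ hσ, b i = .infinite σ hσ := by
    cases hbi : b i <;> simp_all [KroneckerBlock.sizeAtInfinity]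
  obtain ⟨c, hc0, hc, hcs⟩ : ∃ c : ℕ → Fin (b i).cols → ℂ, c 0 ≠ 0 ∧
      (b i).leadMatrix *ᵥ c 0 = 0 ∧ ∀ j, j + 1 < (b i).sizeAtInfinity →
        (b i).constMatrix *ᵥ c j = (b i).leadMatrix *ᵥ c (j + 1) := by
    rw [hbi]
    have key : ∃ c : ℕ → Fin σ → ℂ, c 0 ≠ 0 ∧ jordanBlock σ 0 *ᵥ c 0 = 0 ∧
        ∀ j, j + 1 < σ → (1 : Matrix (Fin σ) (Fin σ) ℂ) *ᵥ c j = jordanBlock σ 0 *ᵥ c (j + 1) := by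
      -- The standard basis is the chain; the value `0` for `j ≥ σ` plays no role.
      refine ⟨fun j => if hj : j < σ then Pi.single ⟨j, hj⟩ 1 else 0, ?_, ?_, ?_⟩
      · simp [hσ]
      · simpa only [dif_pos hσ] using jordanBlock_zero_mulVec_single_zero hσ
      · intro j hj
        simp only
        rw [dif_pos hj, dif_pos (by omega), jordanBlock_zero_mulVec_single_succ, Matrix.one_mulVec]
    exact key
  refine ⟨fun j => φ.symm (Pi.single i (c j)), ?_, ψ.injective ?_, fun j hj => ψ.injective ?_⟩
  · simpa using hc0
  · rw [(h _).1, LinearEquiv.apply_symm_apply, map_zero]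
    ext1 i'
    by_cases hi' : i' = i
    · subst hi'
      simpa using hc
    · simp [Pi.single_eq_of_ne hi']
  · rw [(h _).1, (h _).2, LinearEquiv.apply_symm_apply, LinearEquiv.apply_symm_apply]
    ext1 i'
    by_cases hi' : i' = i
    · subst hi'
      simpa using hcs j hj
    · simp [Pi.single_eq_of_ne hi']

/-- Without a block of the eigenvalue infinity of size at least two, there is no Jordan chain of
length two at infinity. -/
theorem IsKroneckerForm.eq_zero_of_sizeAtInfinity_le_one {m n : ℕ} {E A : Matrix (Fin m) (Fin n) ℂ}
    {k : ℕ} {b : Fin k → KroneckerBlock} (h : IsKroneckerForm E A b) (hsq : ∀ i, (b i).IsSquare)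
    (hsize : ∀ i, (b i).sizeAtInfinity ≤ 1) {x y : Fin n → ℂ} (hx : E *ᵥ x = 0)
    (hxy : A *ᵥ x = E *ᵥ y) : x = 0 := by
  obtain ⟨φ, ψ, h⟩ := (isKroneckerForm_iff E A b).mp h
  -- A finite block has identity lead matrix, so its `v` vanishes. An infinite block of size one has
  -- lead matrix `0` and constant matrix `1`, so the second equation forces `v = 0`.
  have aux : ∀ c : KroneckerBlock, c.IsSquare → c.sizeAtInfinity ≤ 1 → ∀ v w : Fin c.cols → ℂ,
      c.leadMatrix *ᵥ v = 0 → c.constMatrix *ᵥ v = c.leadMatrix *ᵥ w → v = 0 := by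
    rintro (ε | η | ⟨ρ, hρ, μ⟩ | ⟨σ, hσ⟩) hc h1 v w hv hvw
    · exact hc.elim
    · exact hc.elim
    · exact (Matrix.one_mulVec v).symm.trans hv
    · obtain rfl : σ = 1 := le_antisymm h1 hσ
      have h0 : jordanBlock 1 0 = 0 := by
        ext i j
        simp [jordanBlock, Subsingleton.elim i j]
      refine (Matrix.one_mulVec v).symm.trans (hvw.trans ?_)
      exact (congrArg (· *ᵥ w) h0).trans (Matrix.zero_mulVec w)
  refine φ.map_eq_zero_iff.mp (funext fun i => aux (b i) (hsq i) (hsize i) _ (φ y i) ?_ ?_)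
  · rw [← congrFun (h x).1 i, hx, map_zero, Pi.zero_apply]
  · rw [← congrFun (h x).2 i, ← congrFun (h y).1 i, hxy]

end Kronecker

/-! ### Regularity and index two as conditions on real kernels. -/

variable {n : ℕ}

theorem dotProduct_mulVec_of_eq_neg_transpose {J : Matrix (Fin n) (Fin n) ℝ} (hJ : J = -Jᵀ)
    (x y : Fin n → ℝ) : x ⬝ᵥ J *ᵥ y = -(y ⬝ᵥ J *ᵥ x) := by
  conv_lhs => rw [hJ]
  rw [Matrix.neg_mulVec, dotProduct_neg, Matrix.mulVec_transpose, dotProduct_comm,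
    ← Matrix.dotProduct_mulVec]

theorem dotProduct_mulVec_self_of_eq_neg_transpose {J : Matrix (Fin n) (Fin n) ℝ} (hJ : J = -Jᵀ)
    (x : Fin n → ℝ) : x ⬝ᵥ J *ᵥ x = 0 := by
  linarith [dotProduct_mulVec_of_eq_neg_transpose hJ x x]

theorem posSemidef_dotProduct_mulVec_comm {E : Matrix (Fin n) (Fin n) ℝ} (hE : E.PosSemidef)
    (x y : Fin n → ℝ) : x ⬝ᵥ E *ᵥ y = y ⬝ᵥ E *ᵥ x := by
  have h : Eᵀ = E := hE.isHermitian
  conv_lhs => rw [← h]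
  rw [Matrix.mulVec_transpose, dotProduct_comm, ← Matrix.dotProduct_mulVec]

theorem posSemidef_mulVec_eq_zero {E : Matrix (Fin n) (Fin n) ℝ} (hE : E.PosSemidef)
    {x : Fin n → ℝ} (h : x ⬝ᵥ E *ᵥ x = 0) : E *ᵥ x = 0 :=
  (hE.dotProduct_mulVec_zero_iff x).mp (by simpa using h)

theorem posSemidef_dotProduct_mulVec_nonneg {E : Matrix (Fin n) (Fin n) ℝ} (hE : E.PosSemidef)
    (x : Fin n → ℝ) : 0 ≤ x ⬝ᵥ E *ᵥ x := by
  simpa using hE.dotProduct_mulVec_nonneg x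

/-- As the coefficients are real, a complex Jordan chain splits into two real ones, its real and
imaginary parts. -/
theorem re_toComplex_mulVec (M : Matrix (Fin n) (Fin n) ℝ) (x : Fin n → ℂ) :
    (fun i => ((toComplex M *ᵥ x) i).re) = M *ᵥ fun i => (x i).re := by
  ext i
  simp [toComplex, Matrix.mulVec, dotProduct]

theorem im_toComplex_mulVec (M : Matrix (Fin n) (Fin n) ℝ) (x : Fin n → ℂ) :
    (fun i => ((toComplex M *ᵥ x) i).im) = M *ᵥ fun i => (x i).im := by
  ext i
  simp [toComplex, Matrix.mulVec, dotProduct]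

theorem toComplex_mulVec_ofReal (M : Matrix (Fin n) (Fin n) ℝ) (x : Fin n → ℝ) :
    toComplex M *ᵥ (fun i => (x i : ℂ)) = fun i => ((M *ᵥ x) i : ℂ) := by
  ext i
  simp [toComplex, Matrix.mulVec, dotProduct]

theorem eq_zero_of_re_im {x : Fin n → ℂ} (hre : (fun i => (x i).re) = 0)
    (him : (fun i => (x i).im) = 0) : x = 0 :=
  funext fun i => Complex.ext (congrFun hre i) (congrFun him i)

variable {E J R : Matrix (Fin n) (Fin n) ℝ}

theorem isRegular_iff (hE : E.PosSemidef) (hR : R.PosSemidef) (hJ : J = -Jᵀ) :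
    IsRegular (toComplex E) (toComplex (J - R)) ↔
      ∀ x, E *ᵥ x = 0 → R *ᵥ x = 0 → J *ᵥ x = 0 → x = 0 := by
  constructor
  · rintro ⟨z, hz⟩ x h1 h2 h3
    by_contra hx
    refine hz (Matrix.exists_mulVec_eq_zero_iff.mp ⟨fun i => (x i : ℂ), ?_, ?_⟩)
    · exact fun h => hx (funext fun i => Complex.ofReal_injective (congrFun h i))
    · rw [Matrix.sub_mulVec, Matrix.smul_mulVec, toComplex_mulVec_ofReal, toComplex_mulVec_ofReal,
        Matrix.sub_mulVec, h1, h2, h3]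
      ext i
      simp
  · intro h
    -- Any positive `z` would do: a real null vector `y` satisfies `z yᵀEy + yᵀRy = 0`, so both
    -- terms vanish.
    refine ⟨1, fun hdet => ?_⟩
    obtain ⟨x, hx, h0⟩ := Matrix.exists_mulVec_eq_zero_iff.mpr hdet
    have key : ∀ y : Fin n → ℝ, E *ᵥ y = (J - R) *ᵥ y → y = 0 := by
      intro y hy
      have h1 := congrArg (y ⬝ᵥ ·) hy
      simp only [Matrix.sub_mulVec, dotProduct_sub,
        dotProduct_mulVec_self_of_eq_neg_transpose hJ] at h1
      have h2 := posSemidef_dotProduct_mulVec_nonneg hE y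
      have h3 := posSemidef_dotProduct_mulVec_nonneg hR y
      have hEy := posSemidef_mulVec_eq_zero hE (x := y) (by linarith)
      have hRy := posSemidef_mulVec_eq_zero hR (x := y) (by linarith)
      refine h y hEy hRy ?_
      rw [Matrix.sub_mulVec, hEy, hRy, sub_zero] at hy
      exact hy.symm
    rw [one_smul, Matrix.sub_mulVec, sub_eq_zero] at h0
    refine hx (eq_zero_of_re_im (key _ ?_) (key _ ?_))
    · rw [← re_toComplex_mulVec, ← re_toComplex_mulVec, h0]
    · rw [← im_toComplex_mulVec, ← im_toComplex_mulVec, h0]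

/-- A regular dissipative Hamiltonian pencil has no Jordan chain of length three at infinity. -/
theorem eq_zero_of_chain (hE : E.PosSemidef) (hR : R.PosSemidef) (hJ : J = -Jᵀ)
    (h : ∀ x, E *ᵥ x = 0 → R *ᵥ x = 0 → J *ᵥ x = 0 → x = 0) {x y z : Fin n → ℝ}
    (hx : E *ᵥ x = 0) (hxy : (J - R) *ᵥ x = E *ᵥ y) (hyz : (J - R) *ᵥ y = E *ᵥ z) : x = 0 := by
  have hEx : ∀ w, x ⬝ᵥ E *ᵥ w = 0 := fun w => by
    rw [posSemidef_dotProduct_mulVec_comm hE, hx, dotProduct_zero]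
  have hRx : R *ᵥ x = 0 := by
    refine posSemidef_mulVec_eq_zero hR ?_
    have := hEx y
    rw [← hxy, Matrix.sub_mulVec, dotProduct_sub,
      dotProduct_mulVec_self_of_eq_neg_transpose hJ] at this
    linarith
  have hJx : J *ᵥ x = E *ᵥ y := by rw [← hxy, Matrix.sub_mulVec, hRx, sub_zero]
  -- Pairing the last chain equation with `x` gives `0 = xᵀJy = -yᵀJx = -yᵀEy`.
  have hEy : E *ᵥ y = 0 := by
    refine posSemidef_mulVec_eq_zero hE ?_
    have := hEx z
    rw [← hyz, Matrix.sub_mulVec, dotProduct_sub, posSemidef_dotProduct_mulVec_comm hR, hRx,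
      dotProduct_zero, sub_zero, dotProduct_mulVec_of_eq_neg_transpose hJ, hJx] at this
    linarith
  exact h x hx hRx (hJx.trans hEy)

/-- A block of size at least two yields a complex chain, whose start has a nonzero real or imaginary
part. Conversely, in a Weierstrass form `eq_zero_of_chain` excludes sizes above two, and the given
chain excludes that all sizes are at most one. -/
theorem hasIndex_two_iff (hE : E.PosSemidef) (hR : R.PosSemidef) (hJ : J = -Jᵀ)
    (h : IsRegular (toComplex E) (toComplex (J - R))) :
    HasIndex (toComplex E) (toComplex (J - R)) 2 ↔
      ∃ x y, x ≠ 0 ∧ E *ᵥ x = 0 ∧ (J - R) *ᵥ x = E *ᵥ y := by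
  have hreg := (isRegular_iff hE hR hJ).mp h
  constructor
  · rintro ⟨k, b, hb, hsup⟩
    obtain ⟨i, hi⟩ : ∃ i, 1 < (b i).sizeAtInfinity := by
      by_contra! hcon
      have : (Finset.univ.sup fun i => (b i).sizeAtInfinity) ≤ 1 :=
        Finset.sup_le fun i _ => hcon i
      omega
    obtain ⟨x, hx0, hx, hx1⟩ := hb.exists_chain (zero_lt_one.trans hi)
    have hx1 := hx1 0 hi
    by_contra! hcon
    refine hx0 (eq_zero_of_re_im ?_ ?_) <;> by_contra hne
    · refine hcon _ (fun i => (x 1 i).re) hne ?_ ?_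
      · rw [← re_toComplex_mulVec, hx]; rfl
      · rw [← re_toComplex_mulVec, ← re_toComplex_mulVec, hx1]
    · refine hcon _ (fun i => (x 1 i).im) hne ?_ ?_
      · rw [← im_toComplex_mulVec, hx]; rfl
      · rw [← im_toComplex_mulVec, ← im_toComplex_mulVec, hx1]
  · rintro ⟨x, y, hx0, hx, hxy⟩
    obtain ⟨k, b, hb, hsq⟩ := h.exists_isKroneckerForm
    refine ⟨k, b, hb, le_antisymm (Finset.sup_le fun i _ => ?_) ?_⟩
    · by_contra! hi
      obtain ⟨x, hx0, hx, hx1⟩ := hb.exists_chain (i := i) (by omega)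
      have h1 := hx1 0 (by omega)
      have h2 := hx1 1 (by omega)
      refine hx0 (eq_zero_of_re_im ?_ ?_)
      · refine eq_zero_of_chain hE hR hJ hreg (y := fun i => (x 1 i).re)
          (z := fun i => (x 2 i).re) ?_ ?_ ?_
        · rw [← re_toComplex_mulVec, hx]; rfl
        · rw [← re_toComplex_mulVec, ← re_toComplex_mulVec, h1]
        · rw [← re_toComplex_mulVec, ← re_toComplex_mulVec, h2]
      · refine eq_zero_of_chain hE hR hJ hreg (y := fun i => (x 1 i).im)
          (z := fun i => (x 2 i).im) ?_ ?_ ?_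
        · rw [← im_toComplex_mulVec, hx]; rfl
        · rw [← im_toComplex_mulVec, ← im_toComplex_mulVec, h1]
        · rw [← im_toComplex_mulVec, ← im_toComplex_mulVec, h2]
    · by_contra! hlt
      have hle : ∀ i, (b i).sizeAtInfinity ≤ 1 := fun i =>
        (Finset.le_sup (f := fun i => (b i).sizeAtInfinity) (Finset.mem_univ i)).trans (by omega)
      have := hb.eq_zero_of_sizeAtInfinity_le_one hsq hle (x := fun i => (x i : ℂ))
        (y := fun i => (y i : ℂ)) ?_ ?_
      · exact hx0 (funext fun i => Complex.ofReal_injective (congrFun this i))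
      · rw [toComplex_mulVec_ofReal, hx]
        ext i
        simp
      · rw [toComplex_mulVec_ofReal, toComplex_mulVec_ofReal, hxy]

/-! ### Block coordinates, and sufficiency of the block form. -/

/-- The numbering of the rows and columns used by `block3`. -/
def blockEquiv {n p q r : ℕ} (h : p + q + r = n) : (Fin p ⊕ Fin q) ⊕ Fin r ≃ Fin n :=
  ((finSumFinEquiv.sumCongr (Equiv.refl (Fin r))).trans finSumFinEquiv).trans (finCongr h)

/-- The vector of length `n = p + q + r` with the given blocks. -/
def glue {n p q r : ℕ} (h : p + q + r = n) (x : Fin p → ℝ) (y : Fin q → ℝ) (z : Fin r → ℝ) :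
    Fin n → ℝ :=
  Sum.elim (Sum.elim x y) z ∘ (blockEquiv h).symm

theorem exists_eq_glue {n p q r : ℕ} (h : p + q + r = n) (v : Fin n → ℝ) :
    ∃ x y z, v = glue h x y z :=
  ⟨fun i => v (blockEquiv h (.inl (.inl i))), fun i => v (blockEquiv h (.inl (.inr i))),
    fun i => v (blockEquiv h (.inr i)), by
      ext i
      obtain ⟨s, rfl⟩ := (blockEquiv h).surjective i
      rcases s with (s | s) | s <;> simp [glue]⟩

theorem glue_inj {n p q r : ℕ} (h : p + q + r = n) {x x' : Fin p → ℝ} {y y' : Fin q → ℝ}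
    {z z' : Fin r → ℝ} : glue h x y z = glue h x' y' z' ↔ x = x' ∧ y = y' ∧ z = z' := by
  rw [glue, glue, (blockEquiv h).symm.surjective.injective_comp_right.eq_iff, Sum.elim_eq_iff,
    Sum.elim_eq_iff, and_assoc]

theorem glue_zero {n p q r : ℕ} (h : p + q + r = n) : glue h 0 0 0 = 0 := by
  ext i
  obtain ⟨s, rfl⟩ := (blockEquiv h).surjective i
  rcases s with (s | s) | s <;> simp [glue]

theorem block3_mulVec_glue {n p q r : ℕ} (h : p + q + r = n)
    (M₁₁ : Matrix (Fin p) (Fin p) ℝ) (M₁₂ : Matrix (Fin p) (Fin q) ℝ)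
    (M₁₃ : Matrix (Fin p) (Fin r) ℝ)
    (M₂₁ : Matrix (Fin q) (Fin p) ℝ) (M₂₂ : Matrix (Fin q) (Fin q) ℝ)
    (M₂₃ : Matrix (Fin q) (Fin r) ℝ)
    (M₃₁ : Matrix (Fin r) (Fin p) ℝ) (M₃₂ : Matrix (Fin r) (Fin q) ℝ)
    (M₃₃ : Matrix (Fin r) (Fin r) ℝ) (x : Fin p → ℝ) (y : Fin q → ℝ) (z : Fin r → ℝ) :
    block3 h M₁₁ M₁₂ M₁₃ M₂₁ M₂₂ M₂₃ M₃₁ M₃₂ M₃₃ *ᵥ glue h x y z =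
      glue h (M₁₁ *ᵥ x + M₁₂ *ᵥ y + M₁₃ *ᵥ z) (M₂₁ *ᵥ x + M₂₂ *ᵥ y + M₂₃ *ᵥ z)
        (M₃₁ *ᵥ x + M₃₂ *ᵥ y + M₃₃ *ᵥ z) := by
  change Matrix.reindex (blockEquiv h) (blockEquiv h) _ *ᵥ _ = _
  rw [Matrix.reindex_apply, Matrix.submatrix_mulVec_equiv, glue, glue]
  congr 1
  rw [Equiv.symm_symm, Function.comp_assoc, Equiv.symm_comp_self, Function.comp_id,
    Matrix.fromBlocks_mulVec, Sum.elim_comp_inl, Sum.elim_comp_inr, Matrix.fromBlocks_mulVec,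
    Matrix.fromRows_mulVec, Matrix.fromCols_mulVec]
  ext ((i | i) | i) <;> simp

theorem exists_chain_of_block3 {U : Matrix (Fin n) (Fin n) ℝ}
    (hU : U ∈ Matrix.orthogonalGroup (Fin n) ℝ) {p q r : ℕ} (h : p + q + r = n)
    {E₁₁ J₁₁ R₁₁ : Matrix (Fin p) (Fin p) ℝ} {J₁₂ R₁₂ : Matrix (Fin p) (Fin q) ℝ}
    {J₁₃ : Matrix (Fin p) (Fin r) ℝ} {J₂₂ R₂₂ : Matrix (Fin q) (Fin q) ℝ}
    (hE : Uᵀ * E * U = block3 h E₁₁ 0 0 0 0 0 0 0 0)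
    (hJ : Uᵀ * J * U = block3 h J₁₁ J₁₂ J₁₃ (-J₁₂ᵀ) J₂₂ 0 (-J₁₃ᵀ) 0 0)
    (hR : Uᵀ * R * U = block3 h R₁₁ R₁₂ 0 R₁₂ᵀ R₂₂ 0 0 0 0)
    (hr : 0 < r) (hE₁₁ : IsUnit E₁₁) (hA₂₂ : IsUnit (J₂₂ - R₂₂)) (hJ₁₃ : J₁₃.rank = r) :
    (∀ x, E *ᵥ x = 0 → R *ᵥ x = 0 → J *ᵥ x = 0 → x = 0) ∧
      ∃ x y, x ≠ 0 ∧ E *ᵥ x = 0 ∧ (J - R) *ᵥ x = E *ᵥ y := by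
  have hUU : U * Uᵀ = 1 := (Matrix.mem_orthogonalGroup_iff (Fin n) ℝ).mp hU
  have hUU' : Uᵀ * U = 1 := (Matrix.mem_orthogonalGroup_iff' (Fin n) ℝ).mp hU
  have conj : ∀ M y, M *ᵥ (U *ᵥ y) = U *ᵥ ((Uᵀ * M * U) *ᵥ y) := fun M y => by
    rw [Matrix.mulVec_mulVec, Matrix.mulVec_mulVec, ← Matrix.mul_assoc, ← Matrix.mul_assoc, hUU,
      Matrix.one_mul]
  have hUinj : ∀ y, U *ᵥ y = 0 → y = 0 := fun y hy => by
    rw [← Matrix.one_mulVec y, ← hUU', ← Matrix.mulVec_mulVec, hy, Matrix.mulVec_zero]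
  have hJinj : Function.Injective J₁₃.mulVec := by
    have hk := LinearMap.finrank_range_add_finrank_ker J₁₃.mulVecLin
    rw [Module.finrank_fin_fun, ← Matrix.rank, hJ₁₃] at hk
    have : LinearMap.ker J₁₃.mulVecLin = ⊥ := Submodule.finrank_eq_zero.mp (by omega)
    exact LinearMap.ker_eq_bot.mp this
  constructor
  · intro x h1 h2 h3
    obtain ⟨y, rfl⟩ : ∃ y, x = U *ᵥ y :=
      ⟨Uᵀ *ᵥ x, by rw [Matrix.mulVec_mulVec, hUU, Matrix.one_mulVec]⟩
    obtain ⟨a, b, c, rfl⟩ := exists_eq_glue h y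
    rw [conj, hE, block3_mulVec_glue] at h1
    rw [conj, hR, block3_mulVec_glue] at h2
    rw [conj, hJ, block3_mulVec_glue] at h3
    replace h1 := hUinj _ h1
    replace h2 := hUinj _ h2
    replace h3 := hUinj _ h3
    rw [← glue_zero h, glue_inj] at h1 h2 h3
    have ha : a = 0 := by
      refine Matrix.mulVec_injective_iff_isUnit.mpr hE₁₁ ?_
      simpa using h1.1
    subst ha
    have hb : b = 0 := by
      refine Matrix.mulVec_injective_iff_isUnit.mpr hA₂₂ ?_
      have e2 := h2.2.1
      have e3 := h3.2.1
      simp only [Matrix.mulVec_zero, Matrix.zero_mulVec, zero_add, add_zero] at e2 e3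
      rw [Matrix.mulVec_zero, Matrix.sub_mulVec, e2, e3, sub_zero]
    subst hb
    have hc : c = 0 := by
      refine hJinj ?_
      simpa using h3.1
    subst hc
    rw [glue_zero, Matrix.mulVec_zero]
  -- Any nonzero third block `c` would start a chain: `J - R` sends `(0, 0, c)` to `(J₁₃ c, 0, 0)`,
  -- which is `E₁₁` applied to `E₁₁⁻¹ J₁₃ c`.
  · refine ⟨U *ᵥ glue h 0 0 (fun _ => 1), U *ᵥ glue h (E₁₁⁻¹ *ᵥ (J₁₃ *ᵥ fun _ => 1)) 0 0,
      fun h0 => ?_, ?_, ?_⟩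
    · have h0 := hUinj _ h0
      rw [← glue_zero h, glue_inj] at h0
      exact one_ne_zero (congrFun h0.2.2 ⟨0, hr⟩)
    · rw [conj, hE, block3_mulVec_glue]
      simp [glue_zero]
    · have hdet := (Matrix.isUnit_iff_isUnit_det _).mp hE₁₁
      rw [Matrix.sub_mulVec, conj, conj, conj, hE, hJ, hR, block3_mulVec_glue,
        block3_mulVec_glue, block3_mulVec_glue, Matrix.mulVec_mulVec _ E₁₁,
        Matrix.mul_nonsing_inv _ hdet]
      simp [glue_zero]

/-! ### Necessity: an orthonormal basis adapted to the kernels. -/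

/-- Every chain `K₁ ≤ K₀` of subspaces has an adapted orthonormal basis. -/
theorem exists_orthonormal_adapted (K₁ K₀ : Submodule ℝ (EuclideanSpace ℝ (Fin n))) (hK : K₁ ≤ K₀) :
    ∃ (p q r : ℕ) (_ : p + q + r = n)
      (u : (Fin p ⊕ Fin q) ⊕ Fin r → EuclideanSpace ℝ (Fin n)),
      (∀ s t, inner ℝ (u s) (u t) = if s = t then (1 : ℝ) else 0) ∧
      (∀ i, u (.inl (.inl i)) ∈ K₀ᗮ) ∧ (∀ i, u (.inl (.inr i)) ∈ K₁ᗮ ⊓ K₀) ∧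
      ∀ i, u (.inr i) ∈ K₁ := by
  let B₀ := stdOrthonormalBasis ℝ K₀ᗮ
  let B₁ := stdOrthonormalBasis ℝ ↥(K₁ᗮ ⊓ K₀)
  let B₂ := stdOrthonormalBasis ℝ K₁
  refine ⟨_, _, _, ?_, Sum.elim (Sum.elim (fun i => (B₀ i : EuclideanSpace ℝ (Fin n)))
    fun i => (B₁ i : EuclideanSpace ℝ (Fin n))) fun i => (B₂ i : EuclideanSpace ℝ (Fin n)),
    ?_, fun i => (B₀ i).2, fun i => (B₁ i).2, fun i => (B₂ i).2⟩
  · have h1 := Submodule.finrank_add_inf_finrank_orthogonal hK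
    have h2 := K₀.finrank_add_finrank_orthogonal
    rw [finrank_euclideanSpace_fin] at h2
    omega
  · have h0 := orthonormal_iff_ite.mp B₀.orthonormal
    have h1 := orthonormal_iff_ite.mp B₁.orthonormal
    have h2 := orthonormal_iff_ite.mp B₂.orthonormal
    simp only [Submodule.coe_inner] at h0 h1 h2
    rintro ((i | i) | i) ((j | j) | j) <;>
      simp only [Sum.elim_inl, Sum.elim_inr, Sum.inl.injEq, Sum.inr.injEq, reduceCtorEq, if_false]
    · exact h0 i j
    · exact Submodule.inner_left_of_mem_orthogonal (B₁ j).2.2 (B₀ i).2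
    · exact Submodule.inner_left_of_mem_orthogonal (hK (B₂ j).2) (B₀ i).2
    · exact Submodule.inner_right_of_mem_orthogonal (B₁ i).2.2 (B₀ j).2
    · exact h1 i j
    · exact Submodule.inner_left_of_mem_orthogonal (B₂ j).2 (B₁ i).2.1
    · exact Submodule.inner_right_of_mem_orthogonal (hK (B₂ i).2) (B₀ j).2
    · exact Submodule.inner_right_of_mem_orthogonal (B₂ i).2 (B₁ j).2.1
    · exact h2 i j

/-- The matrix of inner products of `v i` with `M w j`. -/
def gram {p q : ℕ} (M : Matrix (Fin n) (Fin n) ℝ) (v : Fin p → Fin n → ℝ) (w : Fin q → Fin n → ℝ) :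
    Matrix (Fin p) (Fin q) ℝ :=
  Matrix.of fun i j => v i ⬝ᵥ M *ᵥ w j

theorem mulVec_sum_smul {q : ℕ} (M : Matrix (Fin n) (Fin n) ℝ) (w : Fin q → Fin n → ℝ)
    (c : Fin q → ℝ) : M *ᵥ ∑ j, c j • w j = ∑ j, c j • M *ᵥ w j := by
  simp only [← Matrix.mulVecLin_apply, map_sum, map_smul]

theorem gram_mulVec {p q : ℕ} (M : Matrix (Fin n) (Fin n) ℝ) (v : Fin p → Fin n → ℝ)
    (w : Fin q → Fin n → ℝ) (c : Fin q → ℝ) (i : Fin p) :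
    (gram M v w *ᵥ c) i = v i ⬝ᵥ M *ᵥ ∑ j, c j • w j := by
  rw [mulVec_sum_smul, dotProduct_sum]
  change ∑ j, gram M v w i j * c j = _
  refine Finset.sum_congr rfl fun j _ => ?_
  rw [dotProduct_smul, smul_eq_mul, mul_comm]
  rfl

theorem dotProduct_sum_smul {q : ℕ} (w : Fin q → Fin n → ℝ) (c : Fin q → ℝ) (x : Fin n → ℝ)
    (h : ∀ j, w j ⬝ᵥ x = 0) : (∑ j, c j • w j) ⬝ᵥ x = 0 := by
  rw [sum_dotProduct]
  exact Finset.sum_eq_zero fun j _ => by rw [smul_dotProduct, h, smul_zero]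

theorem eq_zero_of_sum_smul_eq_zero {q : ℕ} {w : Fin q → Fin n → ℝ}
    (hw : ∀ i j, w i ⬝ᵥ w j = if i = j then 1 else 0) {c : Fin q → ℝ}
    (h : ∑ j, c j • w j = 0) : c = 0 := by
  ext i
  have := congrArg (w i ⬝ᵥ ·) h
  simpa [dotProduct_sum, hw] using this

theorem eq_block3_of_forall {p q r : ℕ} (h : p + q + r = n) {N : Matrix (Fin n) (Fin n) ℝ}
    {M₁₁ : Matrix (Fin p) (Fin p) ℝ} {M₁₂ : Matrix (Fin p) (Fin q) ℝ}
    {M₁₃ : Matrix (Fin p) (Fin r) ℝ}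
    {M₂₁ : Matrix (Fin q) (Fin p) ℝ} {M₂₂ : Matrix (Fin q) (Fin q) ℝ}
    {M₂₃ : Matrix (Fin q) (Fin r) ℝ}
    {M₃₁ : Matrix (Fin r) (Fin p) ℝ} {M₃₂ : Matrix (Fin r) (Fin q) ℝ}
    {M₃₃ : Matrix (Fin r) (Fin r) ℝ}
    (hN : ∀ s t, N (blockEquiv h s) (blockEquiv h t) =
      Matrix.fromBlocks (Matrix.fromBlocks M₁₁ M₁₂ M₂₁ M₂₂) (Matrix.fromRows M₁₃ M₂₃)
        (Matrix.fromCols M₃₁ M₃₂) M₃₃ s t) :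
    N = block3 h M₁₁ M₁₂ M₁₃ M₂₁ M₂₂ M₂₃ M₃₁ M₃₂ M₃₃ := by
  change N = Matrix.reindex (blockEquiv h) (blockEquiv h) _
  ext i j
  obtain ⟨s, rfl⟩ := (blockEquiv h).surjective i
  obtain ⟨t, rfl⟩ := (blockEquiv h).surjective j
  rw [hN, Matrix.reindex_apply, Matrix.submatrix_apply, Equiv.symm_apply_apply,
    Equiv.symm_apply_apply]

theorem exists_block3_of_chain (hE : E.PosSemidef) (hR : R.PosSemidef) (hJ : J = -Jᵀ)
    (hreg : ∀ x, E *ᵥ x = 0 → R *ᵥ x = 0 → J *ᵥ x = 0 → x = 0)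
    (hchain : ∃ x y, x ≠ 0 ∧ E *ᵥ x = 0 ∧ (J - R) *ᵥ x = E *ᵥ y) :
    ∃ U ∈ Matrix.orthogonalGroup (Fin n) ℝ,
    ∃ (p q r : ℕ) (h : p + q + r = n)
      (E₁₁ J₁₁ R₁₁ : Matrix (Fin p) (Fin p) ℝ)
      (J₁₂ R₁₂ : Matrix (Fin p) (Fin q) ℝ)
      (J₁₃ : Matrix (Fin p) (Fin r) ℝ)
      (J₂₂ R₂₂ : Matrix (Fin q) (Fin q) ℝ),
      0 < p ∧ 0 < r ∧
      Uᵀ * E * U = block3 h E₁₁ 0 0 0 0 0 0 0 0 ∧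
      Uᵀ * J * U = block3 h J₁₁ J₁₂ J₁₃ (-J₁₂ᵀ) J₂₂ 0 (-J₁₃ᵀ) 0 0 ∧
      Uᵀ * R * U = block3 h R₁₁ R₁₂ 0 R₁₂ᵀ R₂₂ 0 0 0 0 ∧
      IsUnit E₁₁ ∧ IsUnit (J₂₂ - R₂₂) ∧ J₁₃.rank = r := by
  let K₀ : Submodule ℝ (EuclideanSpace ℝ (Fin n)) :=
    { carrier := {x | E *ᵥ x.ofLp = 0}
      add_mem' := fun {x y} hx hy => by
        rw [Set.mem_ofPred_eq] at *
        rw [WithLp.ofLp_add, Matrix.mulVec_add, hx, hy, add_zero]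
      zero_mem' := Matrix.mulVec_zero _
      smul_mem' := fun c x hx => by
        rw [Set.mem_ofPred_eq] at *
        rw [WithLp.ofLp_smul, Matrix.mulVec_smul, hx, smul_zero] }
  -- By the skewness of `J` and semidefiniteness of `R`, this is the kernel of the compression of `J
  -- - R` to `ker E`. Splitting it off makes `J₂₂ - R₂₂` invertible.
  let K₁ : Submodule ℝ (EuclideanSpace ℝ (Fin n)) :=
    { carrier := {x | E *ᵥ x.ofLp = 0 ∧ R *ᵥ x.ofLp = 0 ∧ ∀ z, E *ᵥ z = 0 → z ⬝ᵥ J *ᵥ x.ofLp = 0}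
      add_mem' := fun {x y} hx hy => by
        refine ⟨?_, ?_, fun z hz => ?_⟩
        · rw [WithLp.ofLp_add, Matrix.mulVec_add, hx.1, hy.1, add_zero]
        · rw [WithLp.ofLp_add, Matrix.mulVec_add, hx.2.1, hy.2.1, add_zero]
        · rw [WithLp.ofLp_add, Matrix.mulVec_add, dotProduct_add, hx.2.2 z hz, hy.2.2 z hz,
            add_zero]
      zero_mem' := ⟨Matrix.mulVec_zero _, Matrix.mulVec_zero _, fun z _ => by simp⟩
      smul_mem' := fun c x hx => by
        refine ⟨?_, ?_, fun z hz => ?_⟩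
        · rw [WithLp.ofLp_smul, Matrix.mulVec_smul, hx.1, smul_zero]
        · rw [WithLp.ofLp_smul, Matrix.mulVec_smul, hx.2.1, smul_zero]
        · rw [WithLp.ofLp_smul, Matrix.mulVec_smul, dotProduct_smul, hx.2.2 z hz, smul_zero] }
  obtain ⟨p, q, r, h, u, hu, hu0, hu1, hu2⟩ :=
    exists_orthonormal_adapted K₁ K₀ fun x hx => hx.1
  have hinner : ∀ x y : EuclideanSpace ℝ (Fin n), inner ℝ x y = x.ofLp ⬝ᵥ y.ofLp := fun x y => by
    rw [EuclideanSpace.inner_eq_star_dotProduct, dotProduct_comm]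
    simp
  let a : Fin p → Fin n → ℝ := fun i => (u (.inl (.inl i))).ofLp
  let b : Fin q → Fin n → ℝ := fun i => (u (.inl (.inr i))).ofLp
  let c : Fin r → Fin n → ℝ := fun i => (u (.inr i)).ofLp
  have haa : ∀ i j, a i ⬝ᵥ a j = if i = j then 1 else 0 := fun i j => by
    rw [← hinner, hu]; simp
  have hbb : ∀ i j, b i ⬝ᵥ b j = if i = j then 1 else 0 := fun i j => by
    rw [← hinner, hu]; simp
  have hcc : ∀ i j, c i ⬝ᵥ c j = if i = j then 1 else 0 := fun i j => by
    rw [← hinner, hu]; simp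
  have ha : ∀ i z, E *ᵥ z = 0 → a i ⬝ᵥ z = 0 := fun i z hz => by
    have := Submodule.inner_left_of_mem_orthogonal (u := WithLp.toLp 2 z) hz (hu0 i)
    rwa [hinner] at this
  have hbE : ∀ i, E *ᵥ b i = 0 := fun i => (hu1 i).2
  have hb : ∀ i z, E *ᵥ z = 0 → R *ᵥ z = 0 → (∀ w, E *ᵥ w = 0 → w ⬝ᵥ J *ᵥ z = 0) →
      b i ⬝ᵥ z = 0 := fun i z hz1 hz2 hz3 => by
    have := Submodule.inner_left_of_mem_orthogonal (K := K₁) (u := WithLp.toLp 2 z)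
      ⟨hz1, hz2, hz3⟩ (hu1 i).1
    rwa [hinner] at this
  have hcE : ∀ i, E *ᵥ c i = 0 := fun i => (hu2 i).1
  have hcR : ∀ i, R *ᵥ c i = 0 := fun i => (hu2 i).2.1
  have hcJ : ∀ i z, E *ᵥ z = 0 → z ⬝ᵥ J *ᵥ c i = 0 := fun i => (hu2 i).2.2
  let U : Matrix (Fin n) (Fin n) ℝ := Matrix.of fun i j => u ((blockEquiv h).symm j) i
  have hentry : ∀ M s t, (Uᵀ * M * U) (blockEquiv h s) (blockEquiv h t) =
      (u s).ofLp ⬝ᵥ M *ᵥ (u t).ofLp := fun M s t => by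
    rw [Matrix.mul_assoc, Matrix.mul_apply']
    congr 1
    · ext i; simp [U]
    · ext i; simp [U, Matrix.mul_apply, Matrix.mulVec, dotProduct]
  have hUU' : Uᵀ * U = 1 := by
    ext i j
    obtain ⟨s, rfl⟩ := (blockEquiv h).surjective i
    obtain ⟨t, rfl⟩ := (blockEquiv h).surjective j
    have := hentry 1 s t
    rw [Matrix.mul_one, Matrix.one_mulVec, ← hinner, hu] at this
    rw [this, Matrix.one_apply]
    simp
  have hU : U ∈ Matrix.orthogonalGroup (Fin n) ℝ :=
    (Matrix.mem_orthogonalGroup_iff' (Fin n) ℝ).mpr hUU'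
  have hcomplete : ∀ x, (∀ i, a i ⬝ᵥ x = 0) → (∀ i, b i ⬝ᵥ x = 0) → (∀ i, c i ⬝ᵥ x = 0) →
      x = 0 := fun x h1 h2 h3 => by
    have hx : Uᵀ *ᵥ x = 0 := by
      ext i
      obtain ⟨s, rfl⟩ := (blockEquiv h).surjective i
      have : (Uᵀ *ᵥ x) (blockEquiv h s) = (u s).ofLp ⬝ᵥ x := by
        simp [U, Matrix.mulVec, dotProduct]
      rw [this]
      rcases s with (s | s) | s
      exacts [h1 s, h2 s, h3 s]
    rw [← Matrix.one_mulVec x, ← mul_eq_one_comm.mp hUU', ← Matrix.mulVec_mulVec, hx,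
      Matrix.mulVec_zero]
  have hcommJ := dotProduct_mulVec_of_eq_neg_transpose hJ
  have hcommE := posSemidef_dotProduct_mulVec_comm hE
  have hcommR := posSemidef_dotProduct_mulVec_comm hR
  -- For a combination `w` of the `c j` in the kernel, `J w` is orthogonal to the whole basis, so `J
  -- w = 0`. Regularity then gives `w = 0`.
  have hrank : (gram J a c).rank = r := by
    have hker : LinearMap.ker (gram J a c).mulVecLin = ⊥ := by
      refine LinearMap.ker_eq_bot'.mpr fun v hv => eq_zero_of_sum_smul_eq_zero hcc ?_
      have hEw : E *ᵥ ∑ j, v j • c j = 0 := by simp [mulVec_sum_smul, hcE]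
      have hRw : R *ᵥ ∑ j, v j • c j = 0 := by simp [mulVec_sum_smul, hcR]
      have hJw : ∀ z, E *ᵥ z = 0 → z ⬝ᵥ J *ᵥ ∑ j, v j • c j = 0 := fun z hz => by
        rw [hcommJ, dotProduct_sum_smul _ _ _ fun j => ?_, neg_zero]
        rw [hcommJ, hcJ j z hz, neg_zero]
      refine hreg _ hEw hRw (hcomplete _ (fun i => ?_) (fun i => hJw _ (hbE i))
        fun i => hJw _ (hcE i))
      rw [← gram_mulVec]
      exact congrFun hv i
    have := LinearMap.finrank_range_add_finrank_ker (gram J a c).mulVecLin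
    rw [hker, finrank_bot, Module.finrank_fin_fun] at this
    exact this
  -- The start of the given chain lies in `K₁`: it is killed by `R`, and `J` sends it into the range
  -- of `E`, orthogonal to `ker E`.
  have hr : 0 < r := by
    by_contra! hr0
    obtain ⟨x, y, hx0, hx, hxy⟩ := hchain
    have hxE : ∀ z, x ⬝ᵥ E *ᵥ z = 0 := fun z => by rw [hcommE, hx, dotProduct_zero]
    have hRx : R *ᵥ x = 0 := by
      refine posSemidef_mulVec_eq_zero hR ?_
      have := hxE y
      rw [← hxy, Matrix.sub_mulVec, dotProduct_sub,
        dotProduct_mulVec_self_of_eq_neg_transpose hJ] at this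
      linarith
    rw [Matrix.sub_mulVec, hRx, sub_zero] at hxy
    refine hx0 (hcomplete x (fun i => ha i x hx) (fun i => hb i x hx hRx fun w hw => ?_)
      fun i => ?_)
    · rw [hxy, hcommE, hw, dotProduct_zero]
    · exact absurd i.2 (by omega)
  refine ⟨U, hU, p, q, r, h, gram E a a, gram J a a, gram R a a, gram J a b, gram R a b,
    gram J a c, gram J b b, gram R b b, ?_, hr, ?_, ?_, ?_, ?_, ?_, hrank⟩
  -- Full column rank forces `r ≤ p`.
  · have := (gram J a c).rank_le_height
    omega
  · refine eq_block3_of_forall h ?_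
    rintro ((i | i) | i) ((j | j) | j) <;> rw [hentry]
    · rfl
    · exact (congrArg _ (hbE j)).trans (dotProduct_zero _)
    · exact (congrArg _ (hcE j)).trans (dotProduct_zero _)
    · exact (hcommE _ _).trans ((congrArg _ (hbE i)).trans (dotProduct_zero _))
    · exact (congrArg _ (hbE j)).trans (dotProduct_zero _)
    · exact (congrArg _ (hcE j)).trans (dotProduct_zero _)
    · exact (hcommE _ _).trans ((congrArg _ (hcE i)).trans (dotProduct_zero _))
    · exact (congrArg _ (hbE j)).trans (dotProduct_zero _)
    · exact (congrArg _ (hcE j)).trans (dotProduct_zero _)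
  · refine eq_block3_of_forall h ?_
    rintro ((i | i) | i) ((j | j) | j) <;> rw [hentry]
    · rfl
    · rfl
    · rfl
    · exact hcommJ _ _
    · rfl
    · exact hcJ j _ (hbE i)
    · exact hcommJ _ _
    · exact (hcommJ _ _).trans (neg_eq_zero.mpr (hcJ i _ (hbE j)))
    · exact hcJ j _ (hcE i)
  · refine eq_block3_of_forall h ?_
    rintro ((i | i) | i) ((j | j) | j) <;> rw [hentry]
    · rfl
    · rfl
    · exact (congrArg _ (hcR j)).trans (dotProduct_zero _)
    · exact hcommR _ _
    · rfl
    · exact (congrArg _ (hcR j)).trans (dotProduct_zero _)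
    · exact (hcommR _ _).trans ((congrArg _ (hcR i)).trans (dotProduct_zero _))
    · exact (hcommR _ _).trans ((congrArg _ (hcR i)).trans (dotProduct_zero _))
    · exact (congrArg _ (hcR j)).trans (dotProduct_zero _)
  · refine Matrix.mulVec_injective_iff_isUnit.mp ?_
    refine (injective_iff_map_eq_zero (gram E a a).mulVecLin).mpr fun v hv =>
      eq_zero_of_sum_smul_eq_zero haa ?_
    -- Here `wᵀEw = 0` puts the combination `w` of the `a j` into `K₀ ⊓ K₀ᗮ`.
    have hEw : E *ᵥ ∑ j, v j • a j = 0 := by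
      refine posSemidef_mulVec_eq_zero hE (dotProduct_sum_smul _ _ _ fun i => ?_)
      rw [← gram_mulVec]
      exact congrFun hv i
    exact dotProduct_self_eq_zero.mp (dotProduct_sum_smul _ _ _ fun i => ha i _ hEw)
  · refine Matrix.mulVec_injective_iff_isUnit.mp ?_
    refine (injective_iff_map_eq_zero (gram J b b - gram R b b).mulVecLin).mpr fun v hv =>
      eq_zero_of_sum_smul_eq_zero hbb ?_
    have hbw : ∀ i, b i ⬝ᵥ J *ᵥ (∑ j, v j • b j) - b i ⬝ᵥ R *ᵥ (∑ j, v j • b j) = 0 := fun i => by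
      rw [← gram_mulVec, ← gram_mulVec, ← Pi.sub_apply, ← Matrix.sub_mulVec]
      exact congrFun hv i
    have hEw : E *ᵥ ∑ j, v j • b j = 0 := by simp [mulVec_sum_smul, hbE]
    -- The aim is `w ∈ K₁`; as `w` also lies in `K₁ᗮ`, it then vanishes.
    set w := ∑ j, v j • b j with hw
    have hRw : R *ᵥ w = 0 := by
      refine posSemidef_mulVec_eq_zero hR ?_
      have : w ⬝ᵥ (J *ᵥ w - R *ᵥ w) = 0 :=
        dotProduct_sum_smul _ _ _ fun i => by rw [dotProduct_sub, hbw]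
      rw [dotProduct_sub, dotProduct_mulVec_self_of_eq_neg_transpose hJ] at this
      linarith
    have hbJ : ∀ i, b i ⬝ᵥ J *ᵥ w = 0 := fun i => by
      have := hbw i
      rwa [hRw, dotProduct_zero, sub_zero] at this
    have hcw : ∀ i, c i ⬝ᵥ J *ᵥ w = 0 := fun i => by rw [hcommJ, hcJ i w hEw, neg_zero]
    have hJw : ∀ z, E *ᵥ z = 0 → z ⬝ᵥ J *ᵥ w = 0 := fun z hz => by
      -- Parseval: in each coordinate one factor is zero, since `z` is orthogonal to the `a i`, and
      -- `J w` to the `b i` and `c i`.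
      have hz' : Uᵀ *ᵥ z ⬝ᵥ Uᵀ *ᵥ (J *ᵥ w) = z ⬝ᵥ J *ᵥ w := by
        rw [Matrix.mulVec_transpose U z, ← Matrix.dotProduct_mulVec, Matrix.mulVec_mulVec,
          mul_eq_one_comm.mp hUU', Matrix.one_mulVec]
      rw [← hz']
      refine Finset.sum_eq_zero fun i _ => ?_
      obtain ⟨s, rfl⟩ := (blockEquiv h).surjective i
      have hcoord : ∀ x, (Uᵀ *ᵥ x) (blockEquiv h s) = (u s).ofLp ⬝ᵥ x := fun x => by
        simp [U, Matrix.mulVec, dotProduct]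
      rw [hcoord, hcoord]
      rcases s with (s | s) | s
      · exact mul_eq_zero_of_left (ha s z hz) _
      · exact mul_eq_zero_of_right _ (hbJ s)
      · exact mul_eq_zero_of_right _ (hcw s)
    exact dotProduct_self_eq_zero.mp (dotProduct_sum_smul _ _ _ fun i => hb i w hEw hRw hJw)

end DHPencil

theorem mainTheorem10 (n : ℕ) (E J R : Matrix (Fin n) (Fin n) ℝ)
    (hE : E.PosSemidef) (hR : R.PosSemidef) (hJ : J = -Jᵀ) :
    (DHPencil.IsRegular (DHPencil.toComplex E) (DHPencil.toComplex (J - R)) ∧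
      DHPencil.HasIndex (DHPencil.toComplex E) (DHPencil.toComplex (J - R)) 2) ↔
    ∃ U ∈ Matrix.orthogonalGroup (Fin n) ℝ,
    ∃ (p q r : ℕ) (h : p + q + r = n)
      (E₁₁ J₁₁ R₁₁ : Matrix (Fin p) (Fin p) ℝ)
      (J₁₂ R₁₂ : Matrix (Fin p) (Fin q) ℝ)
      (J₁₃ : Matrix (Fin p) (Fin r) ℝ)
      (J₂₂ R₂₂ : Matrix (Fin q) (Fin q) ℝ),
      0 < p ∧ 0 < r ∧
      Uᵀ * E * U = DHPencil.block3 h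
        E₁₁ 0 0
        0 0 0
        0 0 0 ∧
      Uᵀ * J * U = DHPencil.block3 h
        J₁₁ J₁₂ J₁₃
        (-J₁₂ᵀ) J₂₂ 0
        (-J₁₃ᵀ) 0 0 ∧
      Uᵀ * R * U = DHPencil.block3 h
        R₁₁ R₁₂ 0
        R₁₂ᵀ R₂₂ 0
        0 0 0 ∧
      IsUnit E₁₁ ∧ IsUnit (J₂₂ - R₂₂) ∧ J₁₃.rank = r := by
  constructor
  · rintro ⟨hreg, hind⟩
    exact DHPencil.exists_block3_of_chain hE hR hJ ((DHPencil.isRegular_iff hE hR hJ).mp hreg)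
      ((DHPencil.hasIndex_two_iff hE hR hJ hreg).mp hind)
  · rintro ⟨U, hU, p, q, r, h, E₁₁, J₁₁, R₁₁, J₁₂, R₁₂, J₁₃, J₂₂, R₂₂,
      -, hr, h1, h2, h3, h4, h5, h6⟩
    obtain ⟨hreg, hchain⟩ := DHPencil.exists_chain_of_block3 hU h h1 h2 h3 hr h4 h5 h6
    have hreg := (DHPencil.isRegular_iff hE hR hJ).mpr hreg
    exact ⟨hreg, (DHPencil.hasIndex_two_iff hE hR hJ hreg).mpr hchain⟩
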